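/- Let $0<p<1$. Consider the single-user updating problem with updating cost $C\in\mathbb{R}$: the Markov decision process with states $(x,\lambda)$, $x\in\{1,2,\dots\}$ (age of information), $\lambda\in\{0,1\}$ (arrival indicator), and actions $a\in\{0,1\}$ ($1$: update, $0$: idle). From $(x,\lambda)$ under action $a$ the next age is $1$ if $a=\lambda=1$ and $x+1$ otherwise, and the next arrival indicator is, independently of everything else, $1$ with probability $p$ and $0$ with probability $1-p$. The immediate cost is $(x+1-x\,a\,\lambda)+C\,a$. The average cost of a (possibly history-dependent and randomized) policy is $\limsup_{T\to\infty}\frac{1}{T+1}E\big[\sum_{t=0}^{T}\mathrm{cost}(\mathbf s(t),a(t))\big]\in(-\infty,\infty]$, and a policy is cost-optimal if, from every initial state, it minimizes the average cost among all policies. An action $a$ is optimal in state $\mathbf s$ if some cost-optimal stationary deterministic policy takes $a$ in $\mathbf s$. The Whittle index $I(\mathbf s)$ is the unique $C\in\mathbb{R}$ for which both actions are optimal (equally desirable) in $\mathbf s$. Theorem. For every $x\in\{1,2,\dots\}$ the Whittle index exists at both states $(x,0)$ and $(x,1)$, and $$I(x,0)=0,\qquad I(x,1)=\frac{x^2}{2}-\frac{x}{2}+\frac{x}{p}.$$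 -/

import Mathlib

open Filter Topology

namespace AoI

/-- A state `(x, l)` of the single-user problem: `x ≥ 1` is the age of information at the user and
`l` tells whether a packet arrives in the current slot. -/
abbrev State : Type := ℕ+ × Bool

/-- `true` is "update the user", `false` is "idle". -/
abbrev Action : Type := Bool

/-- The age in the next slot: one if the user is updated with an arriving packet, otherwise the
age grows by one. -/
def nextAge (s : State) (a : Action) : ℕ+ :=
  if s.2 = true ∧ a = true then 1 else s.1 + 1

/-- The law of an arrival indicator: a packet arrives with probability `p`. -/
noncomputable def arrival (p : unitInterval) : PMF Bool :=
  PMF.ofFintype (fun l => ENNReal.ofReal (if l then (p : ℝ) else 1 - (p : ℝ))) (by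
    simp [← ENNReal.ofReal_add p.2.1 (sub_nonneg.2 p.2.2)])

/-- The transition law: the age moves to `nextAge s a` and the new arrival indicator is
drawn independently of everything else. -/
noncomputable def step (p : unitInterval) (s : State) (a : Action) : PMF State :=
  (arrival p).map fun l => (nextAge s a, l)

/-- The immediate cost `(x + 1 - x·a·l) + C·a`, with `C` the cost of updating. -/
noncomputable def cost (C : ℝ) (s : State) (a : Action) : ℝ :=
  ((s.1 : ℕ) + 1 - (s.1 : ℕ) * (a.toNat : ℝ) * (s.2.toNat : ℝ)) + C * (a.toNat : ℝ)

/-- The past `[(s(0), a(0)), …, (s(t-1), a(t-1))]` of a run. -/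
abbrev History : Type := List (State × Action)

/-- A history dependent, randomized policy: from the past and the current state it gives the
distribution of the current action. -/
abbrev Policy : Type := History → State → PMF Action

/-- The stationary deterministic policy that takes action `f s` whenever the state is `s`. -/
noncomputable def stationary (f : State → Action) : Policy := fun _ s => PMF.pure (f s)

/-- The joint law of the past `[(s(0), a(0)), …, (s(t-1), a(t-1))]` and of the state `s(t)`
when the policy `μ` is used from the initial state `s₀`. -/
noncomputable def law (p : unitInterval) (μ : Policy) (s₀ : State) : ℕ → PMF (History × State)
  | 0 => PMF.pure ([], s₀)
  | t + 1 => (law p μ s₀ t).bind fun z =>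
      (μ z.1 z.2).bind fun a => (step p z.2 a).map fun s' => (z.1 ++ [(z.2, a)], s')

/-- The sum of the immediate costs along a history. -/
noncomputable def totalCost (C : ℝ) (h : History) : ℝ :=
  (h.map fun sa => cost C sa.1 sa.2).sum

/-- Only finitely many histories of a given length have positive probability, so that the sum in
`expectedCost` is a finite one. -/
theorem law_support_finite (p : unitInterval) (μ : Policy) (s₀ : State) (t : ℕ) :
    (law p μ s₀ t).support.Finite := by
  induction t with
  | zero => simp [law]
  | succ t ih =>
    simp only [law, PMF.support_bind, PMF.support_map]
    refine ih.biUnion fun z _ => Set.Finite.biUnion (Set.toFinite _) fun a _ => ?_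
    refine Set.Finite.image _ ?_
    simp only [step, PMF.support_map]
    exact Set.Finite.image _ (Set.toFinite _)

/-- The expected total cost of the first `n` slots `0, …, n-1`. -/
noncomputable def expectedCost (p : unitInterval) (C : ℝ) (μ : Policy) (s₀ : State) (n : ℕ) : ℝ :=
  ∑' z : History × State, (law p μ s₀ n z).toReal * totalCost C z.1

/-- The long-run average cost `limsup_T (1/(T+1)) E[∑_{t=0}^T C(s(t), a(t))]`; it may be `⊤`. -/
noncomputable def averageCost (p : unitInterval) (C : ℝ) (μ : Policy) (s₀ : State) : EReal :=
  limsup (fun T : ℕ => ((1 / ((T : ℝ) + 1) * expectedCost p C μ s₀ (T + 1) : ℝ) : EReal)) atTop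

/-- `μ` minimizes the average cost among all policies, from every initial state. -/
def IsCostOptimal (p : unitInterval) (C : ℝ) (μ : Policy) : Prop :=
  ∀ (s₀ : State) (ν : Policy), averageCost p C μ s₀ ≤ averageCost p C ν s₀

/-- Action `a` is optimal in state `s`: some cost-optimal stationary deterministic policy
takes it there. -/
def IsOptimalAction (p : unitInterval) (C : ℝ) (s : State) (a : Action) : Prop :=
  ∃ f : State → Action, IsCostOptimal p C (stationary f) ∧ f s = a

/-- Both actions are equally desirable in state `s`: idling and updating are both optimal. -/
def EquallyDesirable (p : unitInterval) (C : ℝ) (s : State) : Prop :=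
  IsOptimalAction p C s false ∧ IsOptimalAction p C s true

/-- `I` is the Whittle index of state `s`: the one updating cost `C` that makes both actions
equally desirable in `s`. -/
def IsWhittleIndex (p : unitInterval) (s : State) (I : ℝ) : Prop :=
  ∀ C : ℝ, EquallyDesirable p C s ↔ C = I

end AoI

/-!
For every updating cost `C` the average cost optimality equation
`g + h s = min_a (cost s a + E h(s'))` is solved explicitly (`AoI.isACOESolution_relValue`): if `n`
is the least age with `C ≤ index p n`, updating on arrival is optimal from age `n` on, and the mean
`J x` of `h (x, ·)` over the arrival indicator is quadratic in `x` up to `n` and linear beyond.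
The two actions in `(x, false)` then differ by `C`, and those in `(x, true)` by
`C - (x + J (x + 1))`, which vanishes exactly when `C` is the claimed index (`AoI.eq_idle_iff`).

It remains to see that an action is optimal if and only if it attains the minimum in the equation
(`AoI.IsACOESolution.isOptimalAction_iff`).

* Greedy policies have average cost at most `g`, since `h` is bounded below.
* All policies have average cost at least `g`, although `h` is unbounded above: it grows at most
  linearly in the age, and if the expected age grew linearly in time along a run, the total cost
  would be quadratic (`AoI.not_eventually_le_of_growth`).
* A stationary policy that takes a suboptimal action in a state `t` has average cost above `g`
  (`AoI.IsACOESolution.lt_averageCost`). Slots without arrivals let the age grow whatever the policy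
  does, so every return to age one leads to `t` with positive probability, and returns to age one
  are frequent unless the cost is large. This recurrence is encoded by adding to `h` a small
  bounded potential (`AoI.pathPotential` and a truncated age) for which the optimality inequality
  along the policy holds with a constant larger than `g`.
-/

namespace AoI

/-! ### Expectations over finitely supported laws -/

/-- The expectation of `φ` under `q`. As a `tsum` it is meaningful for finitely supported `q`,
the only ones used here. -/
noncomputable def expect {α : Type*} (q : PMF α) (φ : α → ℝ) : ℝ :=
  ∑' z, (q z).toReal * φ z

section Expect

variable {α β : Type*}

theorem summable_expect {q : PMF α} (hq : q.support.Finite) (φ : α → ℝ) :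
    Summable fun z => (q z).toReal * φ z := by
  refine summable_of_hasFiniteSupport (hq.subset fun z hz => ?_)
  rw [PMF.mem_support_iff]
  intro h0
  simp [h0] at hz

theorem expect_pure (a : α) (φ : α → ℝ) : expect (PMF.pure a) φ = φ a := by
  classical
  unfold expect
  rw [tsum_eq_single a]
  · simp
  · intro b hb
    simp [PMF.pure_apply, hb]

theorem expect_mono {q : PMF α} (hq : q.support.Finite) {φ ψ : α → ℝ}
    (h : ∀ z ∈ q.support, φ z ≤ ψ z) : expect q φ ≤ expect q ψ := by
  refine (summable_expect hq φ).tsum_le_tsum (fun z => ?_) (summable_expect hq ψ)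
  by_cases hz : q z = 0
  · simp [hz]
  · exact mul_le_mul_of_nonneg_left (h z ((PMF.mem_support_iff _ _).2 hz)) ENNReal.toReal_nonneg

theorem expect_add {q : PMF α} (hq : q.support.Finite) (φ ψ : α → ℝ) :
    expect q (fun z => φ z + ψ z) = expect q φ + expect q ψ := by
  unfold expect
  rw [← (summable_expect hq φ).tsum_add (summable_expect hq ψ)]
  simp only [mul_add]

theorem expect_const_mul (q : PMF α) (c : ℝ) (φ : α → ℝ) :
    expect q (fun z => c * φ z) = c * expect q φ := by
  unfold expect
  rw [← tsum_mul_left]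
  exact tsum_congr fun z => by ring

theorem expect_const (q : PMF α) (c : ℝ) : expect q (fun _ => c) = c := by
  unfold expect
  rw [tsum_mul_right, ← ENNReal.tsum_toReal_eq fun z => q.apply_ne_top z, q.tsum_coe]
  simp

theorem expect_bind {q : PMF α} (hq : q.support.Finite) {f : α → PMF β}
    (hf : ∀ a, (f a).support.Finite) (φ : β → ℝ) :
    expect (q.bind f) φ = expect q fun a => expect (f a) φ := by
  have hz : ∀ z, ((q.bind f) z).toReal * φ z
      = ∑ a ∈ hq.toFinset, (q a).toReal * ((f a z).toReal * φ z) := by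
    intro z
    rw [PMF.bind_apply, tsum_eq_sum (s := hq.toFinset), ENNReal.toReal_sum, Finset.sum_mul]
    · exact Finset.sum_congr rfl fun a _ => by rw [ENNReal.toReal_mul]; ring
    · exact fun a _ => ENNReal.mul_ne_top (q.apply_ne_top a) ((f a).apply_ne_top z)
    · intro a ha
      have : q a = 0 := by simpa using ha
      simp [this]
  unfold expect
  rw [tsum_congr hz, Summable.tsum_finsetSum fun a _ => (summable_expect (hf a) φ).mul_left _,
    tsum_eq_sum (s := hq.toFinset)]
  · exact Finset.sum_congr rfl fun a _ => tsum_mul_left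
  · intro a ha
    have : q a = 0 := by simpa using ha
    simp [this]

theorem support_map_finite {q : PMF α} (hq : q.support.Finite) (f : α → β) :
    (q.map f).support.Finite := by
  rw [PMF.support_map]
  exact hq.image f

theorem expect_map {q : PMF α} (hq : q.support.Finite) (f : α → β) (φ : β → ℝ) :
    expect (q.map f) φ = expect q fun a => φ (f a) := by
  have : q.map f = q.bind fun a => PMF.pure (f a) := by
    rw [← PMF.bind_pure_comp]; rfl
  rw [this, expect_bind hq fun a => by simp]
  simp only [expect_pure]

end Expect

theorem expect_arrival (p : unitInterval) (φ : Bool → ℝ) :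
    expect (arrival p) φ = p * φ true + (1 - p) * φ false := by
  unfold expect arrival
  rw [tsum_fintype, Fintype.sum_bool]
  simp [ENNReal.toReal_ofReal p.2.1, ENNReal.toReal_ofReal (sub_nonneg.2 p.2.2)]

theorem expect_law_succ (p : unitInterval) (μ : Policy) (s₀ : State) (n : ℕ)
    (Φ : History × State → ℝ) :
    expect (law p μ s₀ (n + 1)) Φ = expect (law p μ s₀ n) fun z =>
      expect (μ z.1 z.2) fun a => expect (arrival p) fun l =>
        Φ (z.1 ++ [(z.2, a)], (nextAge z.2 a, l)) := by
  have hstep : ∀ s a, (step p s a).support.Finite := fun s a =>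
    support_map_finite (Set.toFinite _) _
  rw [law, expect_bind (law_support_finite p μ s₀ n)]
  · congr 1; funext z
    rw [expect_bind (Set.toFinite _) fun a => support_map_finite (hstep _ _) _]
    congr 1; funext a
    rw [expect_map (hstep _ _), step, expect_map (Set.toFinite _)]
  · intro z
    rw [PMF.support_bind]
    exact Set.Finite.biUnion (Set.toFinite _) fun a _ => support_map_finite (hstep _ _) _

theorem totalCost_concat (C : ℝ) (h : History) (s : State) (a : Action) :
    totalCost C (h ++ [(s, a)]) = totalCost C h + cost C s a := by
  simp [totalCost]

theorem expectedCost_eq (p : unitInterval) (C : ℝ) (μ : Policy) (s₀ : State) (n : ℕ) :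
    expectedCost p C μ s₀ n = expect (law p μ s₀ n) fun z => totalCost C z.1 := rfl

/-! ### Average cost and relative value functions -/

/-- The cost of action `a` in state `s` when the next state is charged with the relative value
function `h`. -/
noncomputable def qValue (p : unitInterval) (C : ℝ) (h : State → ℝ) (s : State) (a : Action) : ℝ :=
  cost C s a + (p * h (nextAge s a, true) + (1 - p) * h (nextAge s a, false))

theorem cost_eq (C : ℝ) (s : State) (a : Action) :
    cost C s a = (nextAge s a : ℕ) + C * (a.toNat : ℝ) := by
  obtain ⟨x, l⟩ := s
  cases l <;> cases a <;> simp [cost, nextAge]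

theorem nextAge_sub_le_cost (C : ℝ) (s : State) (a : Action) :
    ((nextAge s a : ℕ) : ℝ) - |C| ≤ cost C s a := by
  rw [cost_eq]
  cases a
  · simp
  · simpa using by linarith [neg_abs_le C]

theorem expect_totalCost_succ (p : unitInterval) (C : ℝ) (μ : Policy) (s₀ : State) (n : ℕ)
    (h : State → ℝ) :
    expect (law p μ s₀ (n + 1)) (fun z => totalCost C z.1 + h z.2)
      = expect (law p μ s₀ n) fun z => expect (μ z.1 z.2) fun a =>
          totalCost C z.1 + qValue p C h z.2 a := by
  rw [expect_law_succ]
  simp only [expect_arrival, totalCost_concat, qValue]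
  congr 1; funext z; congr 1; funext a; ring

theorem le_expect_totalCost {p : unitInterval} {C g : ℝ} {h : State → ℝ} {μ : Policy}
    (hμ : ∀ H s, ∀ a ∈ (μ H s).support, g + h s ≤ qValue p C h s a) (s₀ : State) (n : ℕ) :
    g * n + h s₀ ≤ expect (law p μ s₀ n) fun z => totalCost C z.1 + h z.2 := by
  induction n with
  | zero => simp [law, expect_pure, totalCost]
  | succ n ih =>
    rw [expect_totalCost_succ]
    have hfin := law_support_finite p μ s₀ n
    have : expect (law p μ s₀ n) (fun z => g + (totalCost C z.1 + h z.2)) ≤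
        expect (law p μ s₀ n) fun z => expect (μ z.1 z.2) fun a =>
          totalCost C z.1 + qValue p C h z.2 a := by
      refine expect_mono hfin fun z _ => ?_
      rw [← expect_const (μ z.1 z.2) (g + (totalCost C z.1 + h z.2))]
      exact expect_mono (Set.toFinite _) fun a ha => by linarith [hμ z.1 z.2 a ha]
    rw [expect_add hfin, expect_const] at this
    push_cast
    linarith

theorem expect_totalCost_le {p : unitInterval} {C g : ℝ} {h : State → ℝ} {μ : Policy}
    (hμ : ∀ H s, ∀ a ∈ (μ H s).support, qValue p C h s a ≤ g + h s) (s₀ : State) (n : ℕ) :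
    expect (law p μ s₀ n) (fun z => totalCost C z.1 + h z.2) ≤ g * n + h s₀ := by
  induction n with
  | zero => simp [law, expect_pure, totalCost]
  | succ n ih =>
    rw [expect_totalCost_succ]
    have hfin := law_support_finite p μ s₀ n
    have : (expect (law p μ s₀ n) fun z => expect (μ z.1 z.2) fun a =>
          totalCost C z.1 + qValue p C h z.2 a) ≤
        expect (law p μ s₀ n) (fun z => g + (totalCost C z.1 + h z.2)) := by
      refine expect_mono hfin fun z _ => ?_
      rw [← expect_const (μ z.1 z.2) (g + (totalCost C z.1 + h z.2))]
      exact expect_mono (Set.toFinite _) fun a ha => by linarith [hμ z.1 z.2 a ha]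
    rw [expect_add hfin, expect_const] at this
    push_cast
    linarith

/-- The expected cost of a slot is, up to the bounded cost of updating, the expected age at the
beginning of the next one. -/
theorem expectedCost_succ_ge (p : unitInterval) (C : ℝ) (μ : Policy) (s₀ : State) (n : ℕ) :
    expectedCost p C μ s₀ n + expect (law p μ s₀ (n + 1)) (fun z => ((z.2.1 : ℕ) : ℝ)) - |C|
      ≤ expectedCost p C μ s₀ (n + 1) := by
  have hfin := law_support_finite p μ s₀ n
  have h1 := expect_totalCost_succ p C μ s₀ n fun s => -((s.1 : ℕ) : ℝ)
  have h2 : expect (law p μ s₀ n) (fun z => -|C| + totalCost C z.1) ≤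
      expect (law p μ s₀ n) fun z => expect (μ z.1 z.2) fun a =>
        totalCost C z.1 + qValue p C (fun s => -((s.1 : ℕ) : ℝ)) z.2 a := by
    refine expect_mono hfin fun z _ => ?_
    rw [← expect_const (μ z.1 z.2) (-|C| + totalCost C z.1)]
    refine expect_mono (Set.toFinite _) fun a _ => ?_
    have := nextAge_sub_le_cost C z.2 a
    simp only [qValue]
    linarith
  rw [← h1, expect_add hfin, expect_const, expect_add (law_support_finite p μ s₀ (n + 1))] at h2
  have h3 := expect_const_mul (law p μ s₀ (n + 1)) (-1) fun z => ((z.2.1 : ℕ) : ℝ)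
  simp only [neg_one_mul] at h3
  rw [h3] at h2
  simp only [expectedCost_eq]
  linarith

/-- A sequence `V` whose increments dominate `A`, and which reaches `g * n` up to a multiple of
`A n`, cannot stay below `r * n` for some `r < g`: the sequence `A` would grow linearly and so `V`
quadratically. -/
theorem not_eventually_le_of_growth {V A : ℕ → ℝ} {g r b c d : ℝ} (hb : 0 < b) (hr : r < g)
    (hV : ∀ n : ℕ, g * n - c ≤ V n + b * A n) (hA : ∀ n : ℕ, V n + A (n + 1) - d ≤ V (n + 1)) :
    ¬ ∀ᶠ n : ℕ in atTop, V n ≤ r * n := by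
  intro hev
  have hlin : ∀ᶠ n : ℕ in atTop, b * (r + 1 + d) + c ≤ (g - r) * n :=
    (tendsto_natCast_atTop_atTop.const_mul_atTop (sub_pos.2 hr)).eventually_ge_atTop _
  obtain ⟨N, hN⟩ := eventually_atTop.1 (hev.and hlin)
  have hinc : ∀ k : ℕ, V N + (r + 1) * k ≤ V (N + k) := by
    intro k
    induction k with
    | zero => simp
    | succ k ih =>
      have h1 := hN (N + k + 1) (by omega)
      have h2 := hV (N + k + 1)
      have h3 := hA (N + k)
      have h4 : b * (r + 1 + d) ≤ b * A (N + k + 1) := by linarith [h1.1, h1.2]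
      have h5 := le_of_mul_le_mul_left h4 hb
      rw [← add_assoc]
      push_cast
      linarith
  obtain ⟨k, hk⟩ := exists_nat_gt (r * N - V N)
  have h1 := hinc k
  have h2 := (hN (N + k) (by omega)).1
  push_cast at h2
  linarith

/-- Lower bound for the average cost from the optimality inequality along the actions that the
policy may take. The function `h` may grow linearly in the age. -/
theorem le_averageCost {p : unitInterval} {C g b c : ℝ} {h : State → ℝ} {μ : Policy}
    (hb : 0 < b) (hh : ∀ s, h s ≤ b * ((s.1 : ℕ) : ℝ) + c)
    (hμ : ∀ H s, ∀ a ∈ (μ H s).support, g + h s ≤ qValue p C h s a) (s₀ : State) :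
    (g : EReal) ≤ averageCost p C μ s₀ := by
  by_contra! hlt
  obtain ⟨r, hr1, hr2⟩ := EReal.lt_iff_exists_real_btwn.1 hlt
  have hr2 : r < g := by exact_mod_cast hr2
  have hev := eventually_lt_of_limsup_lt hr1
  refine not_eventually_le_of_growth (V := expectedCost p C μ s₀)
    (A := fun n => expect (law p μ s₀ n) (fun z => ((z.2.1 : ℕ) : ℝ)))
    (c := c - h s₀) (d := |C|) hb hr2 ?_ (expectedCost_succ_ge p C μ s₀) ?_
  · intro n
    have hfin := law_support_finite p μ s₀ n
    have h1 := le_expect_totalCost hμ s₀ n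
    have h2 : expect (law p μ s₀ n) (fun z => h z.2) ≤
        expect (law p μ s₀ n) (fun z => b * ((z.2.1 : ℕ) : ℝ) + c) :=
      expect_mono hfin fun z _ => hh z.2
    rw [expect_add hfin, expect_const_mul, expect_const] at h2
    rw [expect_add hfin] at h1
    rw [expectedCost_eq]
    linarith
  · obtain ⟨N, hN⟩ := eventually_atTop.1 hev
    refine eventually_atTop.2 ⟨N + 1, fun n hn => ?_⟩
    obtain ⟨k, rfl⟩ : ∃ k, n = k + 1 := ⟨n - 1, by omega⟩
    have h1 := hN k (by omega)
    have h1 : 1 / ((k : ℝ) + 1) * expectedCost p C μ s₀ (k + 1) < r := by exact_mod_cast h1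
    have hk : (0 : ℝ) < (k : ℝ) + 1 := by positivity
    rw [one_div, inv_mul_lt_iff₀ hk] at h1
    push_cast
    linarith

theorem averageCost_le {p : unitInterval} {C g c : ℝ} {h : State → ℝ} {μ : Policy}
    (hh : ∀ s, c ≤ h s) (hμ : ∀ H s, ∀ a ∈ (μ H s).support, qValue p C h s a ≤ g + h s)
    (s₀ : State) : averageCost p C μ s₀ ≤ (g : EReal) := by
  have hlim : Tendsto (fun T : ℕ => ((g + (h s₀ - c) * (1 / ((T : ℝ) + 1)) : ℝ) : EReal)) atTop
      (𝓝 (g : EReal)) := by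
    refine (continuous_coe_real_ereal.tendsto g).comp ?_
    simpa using (tendsto_one_div_add_atTop_nhds_zero_nat (𝕜 := ℝ)).const_mul (h s₀ - c)
      |>.const_add g
  rw [← hlim.limsup_eq]
  refine limsup_le_limsup (Eventually.of_forall fun T => ?_)
  have hfin := law_support_finite p μ s₀ (T + 1)
  have h1 := expect_totalCost_le hμ s₀ (T + 1)
  have h2 := expect_mono hfin (φ := fun _ => c) (ψ := fun z => h z.2) fun z _ => hh z.2
  rw [expect_add hfin, ← expectedCost_eq] at h1
  rw [expect_const] at h2
  have hk : (0 : ℝ) < (T : ℝ) + 1 := by positivity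
  have h3 : expectedCost p C μ s₀ (T + 1) ≤ g * ((T : ℝ) + 1) + (h s₀ - c) := by
    push_cast at h1
    linarith
  have h4 := mul_le_mul_of_nonneg_left h3 (one_div_pos.2 hk).le
  have h5 : 1 / ((T : ℝ) + 1) * (g * ((T : ℝ) + 1) + (h s₀ - c))
      = g + (h s₀ - c) * (1 / ((T : ℝ) + 1)) := by
    field_simp
  rw [h5] at h4
  exact EReal.coe_le_coe_iff.2 h4

/-! ### Recurrence of every state -/

/-- A potential that rises along the arrival-free path from age one to the state `t`, where it
is spent. -/
noncomputable def pathPotential (r : ℝ) (t s : State) : ℝ :=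
  open Classical in if s = t ∨ (s.1 < t.1 ∧ s.2 = false) then r ^ (s.1 : ℕ) else 0

theorem pathPotential_nonneg {r : ℝ} (hr : 0 ≤ r) (t s : State) : 0 ≤ pathPotential r t s := by
  unfold pathPotential
  split_ifs
  · positivity
  · exact le_rfl

theorem pathPotential_le {r : ℝ} (hr : 1 ≤ r) (t s : State) :
    pathPotential r t s ≤ r ^ (t.1 : ℕ) := by
  unfold pathPotential
  split_ifs with h
  · refine pow_le_pow_right₀ hr ?_
    rcases h with rfl | h
    · exact le_rfl
    · exact_mod_cast h.1.le
  · positivity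

theorem le_expect_pathPotential {p r : ℝ} (hp0 : 0 < p) (hp1 : p < 1) (hr : r = (p * (1 - p))⁻¹)
    (t : State) {y : ℕ+} (hy : y ≤ t.1) {k : ℕ} (hk : (y : ℕ) = k + 1) :
    r ^ k ≤ p * pathPotential r t (y, true) + (1 - p) * pathPotential r t (y, false) := by
  have hq : 0 < 1 - p := sub_pos.2 hp1
  have hr0 : 0 < r := by rw [hr]; positivity
  have hpr : 1 ≤ p * r := by
    have : p * r = (1 - p)⁻¹ := by rw [hr]; field_simp
    rw [this]
    exact (one_le_inv₀ hq).2 (by linarith)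
  have hqr : 1 ≤ (1 - p) * r := by
    have : (1 - p) * r = p⁻¹ := by rw [hr]; field_simp
    rw [this]
    exact (one_le_inv₀ hp0).2 hp1.le
  have hk0 : 0 < r ^ k := by positivity
  have h1 := pathPotential_nonneg hr0.le t (y, true)
  have h2 := pathPotential_nonneg hr0.le t (y, false)
  by_cases ht : (y, true) = t
  · have : pathPotential r t (y, true) = r ^ (k + 1) := by simp [pathPotential, ht, hk]
    rw [this, pow_succ]
    nlinarith [mul_nonneg hq.le h2, mul_le_mul_of_nonneg_left hpr hk0.le]
  · have : pathPotential r t (y, false) = r ^ (k + 1) := by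
      unfold pathPotential
      rw [if_pos, hk]
      rcases hy.lt_or_eq with hlt | heq
      · exact Or.inr ⟨hlt, rfl⟩
      · left
        obtain ⟨x, l⟩ := t
        cases l
        · simpa using heq
        · exact absurd (by simpa using heq) ht
    rw [this, pow_succ]
    nlinarith [mul_nonneg hp0.le h1, mul_le_mul_of_nonneg_left hqr hk0.le]

/-- Away from `t`, the potential does not decrease on average, and it rises by one whenever the
age is reset. -/
theorem pathPotential_drift {p r : ℝ} (hp0 : 0 < p) (hp1 : p < 1) (hr : r = (p * (1 - p))⁻¹)
    {t s : State} (hs : s ≠ t) (a : Action) :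
    pathPotential r t s + (if nextAge s a = 1 then 1 else 0) ≤
      p * pathPotential r t (nextAge s a, true)
        + (1 - p) * pathPotential r t (nextAge s a, false) := by
  have hq : 0 < 1 - p := sub_pos.2 hp1
  have hr0 : 0 < r := by rw [hr]; positivity
  by_cases hreset : s.2 = true ∧ a = true
  · have h1 : nextAge s a = 1 := by simp [nextAge, hreset]
    have h2 : pathPotential r t s = 0 := by simp [pathPotential, hs, hreset.1]
    have := le_expect_pathPotential hp0 hp1 hr t one_le (k := 0) (by simp)
    simpa [h1, h2] using this
  · have h1 : nextAge s a = s.1 + 1 := by simp only [nextAge, if_neg hreset]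
    have h2 : s.1 + 1 ≠ 1 := by
      intro h
      have := congrArg PNat.val h
      simp at this
    rw [h1, if_neg h2, add_zero]
    by_cases h3 : s.1 < t.1 ∧ s.2 = false
    · have : pathPotential r t s = r ^ (s.1 : ℕ) := by simp [pathPotential, h3]
      rw [this]
      exact le_expect_pathPotential hp0 hp1 hr t (PNat.add_one_le_iff.2 h3.1) (by simp)
    · have : pathPotential r t s = 0 := by simp [pathPotential, hs, h3]
      rw [this]
      have h4 := pathPotential_nonneg hr0.le t (s.1 + 1, true)
      have h5 := pathPotential_nonneg hr0.le t (s.1 + 1, false)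
      positivity

theorem min_nextAge_drift (X : ℕ) (hX : 1 ≤ X) (s : State) (a : Action) :
    min ((s.1 : ℕ) : ℝ) X + (if (nextAge s a : ℕ) ≤ X then 1 else 0) ≤
      min ((nextAge s a : ℕ) : ℝ) X + X * (if nextAge s a = 1 then 1 else 0) := by
  have hX' : (1 : ℝ) ≤ X := by exact_mod_cast hX
  by_cases hreset : s.2 = true ∧ a = true
  · have h1 : nextAge s a = 1 := by simp [nextAge, hreset]
    have := min_le_right ((s.1 : ℕ) : ℝ) (X : ℝ)
    simp only [h1, PNat.val_ofNat, hX, if_true, Nat.cast_one, min_eq_left hX']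
    linarith
  · have h1 : nextAge s a = s.1 + 1 := by simp only [nextAge, if_neg hreset]
    have h2 : s.1 + 1 ≠ 1 := by
      intro h
      have := congrArg PNat.val h
      simp at this
    rw [h1, if_neg h2]
    by_cases h : ((s.1 + 1 : ℕ+) : ℕ) ≤ X
    · rw [if_pos h]
      simp only [PNat.add_coe, PNat.val_ofNat] at h ⊢
      have h' : (((s.1 : ℕ) + 1 : ℕ) : ℝ) ≤ X := by exact_mod_cast h
      rw [min_eq_left h', min_eq_left (by push_cast at h'; linarith)]
      push_cast
      linarith
    · rw [if_neg h]
      simp only [PNat.add_coe, PNat.val_ofNat] at h ⊢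
      have h' : (X : ℝ) ≤ ((s.1 : ℕ) : ℝ) := by
        have : X ≤ (s.1 : ℕ) := by omega
        exact_mod_cast this
      rw [min_eq_right h', min_eq_right (by push_cast; linarith)]
      linarith

/-! ### Solutions of the average cost optimality equation -/

/-- `g` and `h` solve the average cost optimality equation `g + h s = min_a qValue s a`, and `h` is
bounded below and grows at most linearly in the age. -/
structure IsACOESolution (p : unitInterval) (C g : ℝ) (h : State → ℝ) : Prop where
  le_qValue : ∀ s a, g + h s ≤ qValue p C h s a
  attained : ∀ s, ∃ a, qValue p C h s a = g + h s
  upper : ∃ b > 0, ∃ c, ∀ s, h s ≤ b * ((s.1 : ℕ) : ℝ) + c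
  lower : ∃ c, ∀ s, c ≤ h s

/-- Every state is visited with positive frequency under a policy of finite average cost, so a
stationary policy which takes a suboptimal action in one state has average cost bounded away
from `g`. -/
theorem IsACOESolution.lt_averageCost {p : unitInterval} (hp0 : 0 < (p : ℝ)) (hp1 : (p : ℝ) < 1)
    {C g : ℝ} {h : State → ℝ} (H : IsACOESolution p C g h) {f : State → Action} {t : State}
    (ht : g + h t < qValue p C h t (f t)) (s₀ : State) :
    (g : EReal) < averageCost p C (stationary f) s₀ := by
  obtain ⟨b, hb, c, hc⟩ := H.upper
  set K : ℝ := |g| + |C| with hK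
  have hK0 : 0 ≤ K := by positivity
  obtain ⟨X, hX⟩ := exists_nat_ge (K + 1)
  have hX1 : 1 ≤ X := by
    have : (1 : ℝ) ≤ X := by linarith
    exact_mod_cast this
  have hX0 : (0 : ℝ) ≤ X := Nat.cast_nonneg X
  obtain ⟨r, hr⟩ : ∃ r : ℝ, r = ((p : ℝ) * (1 - p))⁻¹ := ⟨_, rfl⟩
  have hq : 0 < 1 - (p : ℝ) := sub_pos.2 hp1
  have hr1 : 1 ≤ r := by
    rw [hr]
    exact (one_le_inv₀ (by positivity)).2 (by nlinarith)
  set R := r ^ (t.1 : ℕ) with hR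
  have hR0 : 0 < R := by positivity
  set δ := qValue p C h t (f t) - (g + h t) with hδ
  have hδ0 : 0 < δ := sub_pos.2 ht
  -- `W` bounds the loss, in units of `θ`, that the correction of `h` may cause in the state `t`.
  set W := 1 + K + (K + 1) * (X + X * R) with hW
  have hW0 : 0 < W := by positivity
  set θ := δ / (δ + W) with hθ
  have hθ0 : 0 < θ := by positivity
  have hθ1 : θ < 1 := (div_lt_one (by positivity)).2 (by linarith)
  have hθδ : θ * W = (1 - θ) * δ := by rw [hθ]; field_simp; ring
  set w : State → ℝ := fun s => min ((s.1 : ℕ) : ℝ) X + X * pathPotential r t s with hw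
  have hlow : ((g + θ : ℝ) : EReal) ≤ averageCost p C (stationary f) s₀ := by
    refine le_averageCost (h := fun s => (1 - θ) * h s + θ * (K + 1) * w s)
      (b := (1 - θ) * b) (c := (1 - θ) * c + θ * (K + 1) * (X + X * R))
      (mul_pos (by linarith) hb) ?_ ?_ s₀
    · intro s
      have h1 := mul_le_mul_of_nonneg_left (hc s) (sub_nonneg.2 hθ1.le)
      have h2 : w s ≤ X + X * R := add_le_add (min_le_right _ _)
        (mul_le_mul_of_nonneg_left (pathPotential_le hr1 t s) hX0)
      have h3 := mul_le_mul_of_nonneg_left h2 (show 0 ≤ θ * (K + 1) by positivity)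
      linarith
    · intro _ s a ha
      obtain rfl : a = f s := by simpa [stationary] using ha
      set y := nextAge s (f s) with hy
      have hcost := nextAge_sub_le_cost C s (f s)
      have hg := le_abs_self g
      have hq1 := H.le_qValue s (f s)
      have hmin := min_nextAge_drift X hX1 s (f s)
      rw [← hy] at hcost hmin
      have hy1 : (1 : ℝ) ≤ ((y : ℕ) : ℝ) := by exact_mod_cast y.pos
      -- the increment of the correction `w`
      set D := p * w (y, true) + (1 - p) * w (y, false) - w s with hD
      have hDeq : D = min ((y : ℕ) : ℝ) X - min ((s.1 : ℕ) : ℝ) X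
          + X * (p * pathPotential r t (y, true) + (1 - p) * pathPotential r t (y, false)
            - pathPotential r t s) := by
        simp only [hD, hw]; ring
      have hgoal : qValue p C (fun s => (1 - θ) * h s + θ * (K + 1) * w s) s (f s)
          - (g + ((1 - θ) * h s + θ * (K + 1) * w s))
          = (1 - θ) * (qValue p C h s (f s) - (g + h s)) + θ * (cost C s (f s) - g)
            + θ * (K + 1) * D := by
        simp only [qValue, hD, ← hy]; ring
      have hmain : θ ≤ (1 - θ) * (qValue p C h s (f s) - (g + h s))
          + θ * (cost C s (f s) - g) + θ * (K + 1) * D := by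
        have hcg : (y : ℕ) - K ≤ cost C s (f s) - g := by linarith
        have h1 := mul_le_mul_of_nonneg_left hcg hθ0.le
        by_cases hst : s = t
        · have h2 : -(X + X * R) ≤ D := by
            have h3 := pathPotential_nonneg (by linarith : 0 ≤ r) t (y, true)
            have h4 := pathPotential_nonneg (by linarith : 0 ≤ r) t (y, false)
            have h5 := mul_le_mul_of_nonneg_left (pathPotential_le hr1 t s) hX0
            have h6 : 0 ≤ (X : ℝ) * ((p : ℝ) * pathPotential r t (y, true)
              + (1 - (p : ℝ)) * pathPotential r t (y, false)) := by positivity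
            have h7 : 0 ≤ min ((y : ℕ) : ℝ) (X : ℝ) := by positivity
            have h8 := min_le_right ((s.1 : ℕ) : ℝ) (X : ℝ)
            rw [hDeq]
            linarith
          have h3 := mul_le_mul_of_nonneg_left h2 (show 0 ≤ θ * (K + 1) by positivity)
          have h4 : qValue p C h s (f s) - (g + h s) = δ := by rw [hst]
          have h5 := mul_le_mul_of_nonneg_left hy1 hθ0.le
          rw [h4, ← hθδ, hW]
          linarith
        · have hpot := mul_le_mul_of_nonneg_left
            (pathPotential_drift hp0 hp1 hr hst (f s)) hX0
          rw [← hy] at hpot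
          have h2 : (if (y : ℕ) ≤ X then (1 : ℝ) else 0) ≤ D := by
            rw [hDeq]
            linarith
          have h3 := mul_nonneg (sub_nonneg.2 hθ1.le) (sub_nonneg.2 hq1)
          have h4 := mul_le_mul_of_nonneg_left h2 (show 0 ≤ θ * (K + 1) by positivity)
          split_ifs at h4 with h5
          · have h6 := mul_le_mul_of_nonneg_left hy1 hθ0.le
            linarith
          · have h6 : (X : ℝ) ≤ (y : ℕ) := by exact_mod_cast (not_le.1 h5).le
            have h7 := mul_le_mul_of_nonneg_left (show 1 ≤ (y : ℕ) - K by linarith) hθ0.le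
            linarith
      linarith
  refine lt_of_lt_of_le ?_ hlow
  exact_mod_cast (by linarith : g < g + θ)

theorem IsACOESolution.le_averageCost {p : unitInterval} {C g : ℝ} {h : State → ℝ}
    (H : IsACOESolution p C g h) (μ : Policy) (s₀ : State) :
    (g : EReal) ≤ averageCost p C μ s₀ := by
  obtain ⟨b, hb, c, hc⟩ := H.upper
  exact AoI.le_averageCost hb hc (fun _ s a _ => H.le_qValue s a) s₀

theorem IsACOESolution.isOptimalAction_iff {p : unitInterval} (hp0 : 0 < (p : ℝ))
    (hp1 : (p : ℝ) < 1) {C g : ℝ} {h : State → ℝ} (H : IsACOESolution p C g h)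
    (s : State) (a : Action) :
    IsOptimalAction p C s a ↔ qValue p C h s a = g + h s := by
  obtain ⟨c, hc⟩ := H.lower
  have hgreedy : ∀ f : State → Action, (∀ s, qValue p C h s (f s) = g + h s) →
      ∀ s₀, averageCost p C (stationary f) s₀ ≤ g := by
    intro f hf s₀
    refine averageCost_le hc (fun _ s a ha => ?_) s₀
    obtain rfl : a = f s := by simpa [stationary] using ha
    exact (hf s).le
  choose f hf using H.attained
  constructor
  · rintro ⟨f', hopt, rfl⟩
    by_contra hne
    have h1 := H.lt_averageCost hp0 hp1 (lt_of_le_of_ne (H.le_qValue s (f' s)) (Ne.symm hne)) s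
    exact absurd ((hopt s (stationary f)).trans (hgreedy f hf s)) (not_le.2 h1)
  · intro ha
    classical
    refine ⟨Function.update f s a, fun s₀ ν => (hgreedy _ ?_ s₀).trans (H.le_averageCost ν s₀),
      by simp⟩
    intro s'
    by_cases hs : s' = s
    · subst hs; simpa using ha
    · simpa [Function.update_of_ne hs] using hf s'

theorem IsACOESolution.equallyDesirable_iff {p : unitInterval} (hp0 : 0 < (p : ℝ))
    (hp1 : (p : ℝ) < 1) {C g : ℝ} {h : State → ℝ} (H : IsACOESolution p C g h) (s : State) :
    EquallyDesirable p C s ↔ qValue p C h s true = qValue p C h s false := by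
  rw [EquallyDesirable, H.isOptimalAction_iff hp0 hp1, H.isOptimalAction_iff hp0 hp1]
  refine ⟨fun h => h.2.trans h.1.symm, fun heq => ?_⟩
  obtain ⟨a, ha⟩ := H.attained s
  cases a
  · exact ⟨ha, heq.trans ha⟩
  · exact ⟨heq.symm.trans ha, ha⟩

/-! ### The explicit solution -/

/-- The claimed index of the state `(x, true)`. -/
noncomputable def index (p : ℝ) (x : ℕ) : ℝ := (x : ℝ) ^ 2 / 2 - (x : ℝ) / 2 + (x : ℝ) / p

theorem index_strictMono {p : ℝ} (hp0 : 0 < p) : StrictMono (index p) := by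
  refine strictMono_nat_of_lt_succ fun x => ?_
  have h1 : index p (x + 1) - index p x = x + 1 / p := by
    unfold index
    push_cast
    ring
  have : 0 < (x : ℝ) + 1 / p := by positivity
  linarith

/-- The least `n ≥ 1` with `C ≤ index p n`: the age from which updating is optimal. -/
theorem exists_threshold {p : ℝ} (hp0 : 0 < p) (hp1 : p < 1) (C : ℝ) :
    ∃ n : ℕ, 1 ≤ n ∧ C ≤ index p n ∧ (n = 1 ∨ index p (n - 1) < C) := by
  have hex : ∃ n : ℕ, 1 ≤ n ∧ C ≤ index p n := by
    obtain ⟨n, hn⟩ := exists_nat_ge (max C 1)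
    have hn1 : (1 : ℝ) ≤ n := (le_max_right _ _).trans hn
    refine ⟨n, by exact_mod_cast hn1, ?_⟩
    have h1 : (n : ℝ) ≤ n / p := (le_div_iff₀ hp0).2 (by nlinarith)
    have h2 := le_max_left C 1
    unfold index
    nlinarith
  classical
  refine ⟨Nat.find hex, (Nat.find_spec hex).1, (Nat.find_spec hex).2, ?_⟩
  by_cases h1 : Nat.find hex = 1
  · exact Or.inl h1
  · right
    have h2 := (Nat.find_spec hex).1
    by_contra! h3
    exact Nat.find_min hex (m := Nat.find hex - 1) (by omega) ⟨by omega, h3⟩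

/-- The optimal average cost when updating is optimal from age `n` on. The term `min C 0` is the
(negative) cost of updating in the slots without arrival, which pays off when `C < 0`. -/
noncomputable def gain (p C : ℝ) (n : ℕ) : ℝ :=
  (p * (n - 1) * (1 + n / 2) + p + p * C + (1 - p) * (n + 1 / p + min C 0)) / (p * (n - 1) + 1)

/-- The mean over the arrival indicator of the relative value at age `x`, normalized to vanish at
age one: quadratic up to the threshold `n`, linear from there on. -/
noncomputable def meanValue (p C : ℝ) (n x : ℕ) : ℝ :=
  if x ≤ n then (x - 1) * (gain p C n - 1 - x / 2)
  else (n - 1) * (gain p C n - 1 - n / 2) + (x - n) * ((1 - p) / p)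

/-- The relative value function: in state `(x, l)` the better of idling and updating. -/
noncomputable def relValue (p C : ℝ) (n : ℕ) (s : State) : ℝ :=
  if s.2 then min ((s.1 : ℕ) + meanValue p C n (s.1 + 1)) C + 1 - gain p C n
  else (s.1 : ℕ) + meanValue p C n (s.1 + 1) + min C 0 + 1 - gain p C n

section Explicit

variable {p C : ℝ} {n : ℕ}

theorem meanValue_of_le {x : ℕ} (hx : x ≤ n) :
    meanValue p C n x = (x - 1) * (gain p C n - 1 - x / 2) := if_pos hx

theorem meanValue_of_ge {x : ℕ} (hx : n ≤ x) :
    meanValue p C n x = (n - 1) * (gain p C n - 1 - n / 2) + (x - n) * ((1 - p) / p) := by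
  rcases hx.eq_or_lt with rfl | h
  · rw [meanValue_of_le le_rfl]; ring
  · exact if_neg (not_le.2 h)

theorem gain_mul (hp0 : 0 < p) (hn : 1 ≤ n) : gain p C n * (p * (n - 1) + 1) =
    p * (n - 1) * (1 + n / 2) + p + p * C + (1 - p) * (n + 1 / p + min C 0) := by
  have : (1 : ℝ) ≤ n := by exact_mod_cast hn
  have h2 : 0 ≤ p * ((n : ℝ) - 1) := mul_nonneg hp0.le (by linarith)
  exact div_mul_cancel₀ _ (by linarith)

theorem min_eq_zero_of_threshold (hp0 : 0 < p) (hn : n = 1 ∨ index p (n - 1) < C)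
    (h1 : n ≠ 1) : min C 0 = 0 := by
  have h2 := hn.resolve_left h1
  have h3 := (index_strictMono hp0).monotone (Nat.zero_le (n - 1))
  have h4 : index p 0 = 0 := by simp [index]
  exact min_eq_right (by linarith)

theorem threshold_identity (hp0 : 0 < p) (hn : 1 ≤ n) :
    (p * (n - 1) + 1) * (C - (n + meanValue p C n (n + 1))) =
      C - (n - 1) * (1 - p) * min C 0 - index p n := by
  rw [meanValue_of_ge (Nat.le_succ n)]
  have h := gain_mul (C := C) hp0 hn
  have h2 : (p * (n - 1) + 1) *
      (C - (n + ((n - 1) * (gain p C n - 1 - n / 2) + ((n + 1 : ℕ) - n) * ((1 - p) / p))))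
      = (p * (n - 1) + 1) *
      (C - (n + ((n - 1) * (- 1 - n / 2) + ((n + 1 : ℕ) - n) * ((1 - p) / p))))
      - (n - 1) * (gain p C n * (p * (n - 1) + 1)) := by ring
  rw [h2, h]
  unfold index
  push_cast
  field_simp
  ring

theorem pred_threshold_identity (hp0 : 0 < p) (hn : 1 ≤ n) (h0 : min C 0 = 0) :
    (p * (n - 1) + 1) * (C - ((n - 1) + meanValue p C n n)) =
      C - index p (n - 1) := by
  rw [meanValue_of_le le_rfl]
  have h := gain_mul (C := C) hp0 hn
  have h2 : (p * (n - 1) + 1) * (C - ((n - 1) + (n - 1) * (gain p C n - 1 - n / 2)))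
      = (p * (n - 1) + 1) * (C - ((n - 1) + (n - 1) * (- 1 - n / 2)))
      - (n - 1) * (gain p C n * (p * (n - 1) + 1)) := by ring
  rw [h2, h, h0]
  unfold index
  push_cast [hn]
  field_simp
  ring

theorem sub_threshold (hp0 : 0 < p) (hn : 1 ≤ n) (hC : n = 1 ∨ index p (n - 1) < C) :
    (p * (n - 1) + 1) * (C - (n + meanValue p C n (n + 1))) = C - index p n := by
  rw [threshold_identity hp0 hn]
  by_cases h1 : n = 1
  · simp [h1]
  · simp [min_eq_zero_of_threshold hp0 hC h1]

theorem factor_pos (hp0 : 0 < p) (hn : 1 ≤ n) : 0 < p * ((n : ℝ) - 1) + 1 := by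
  have : (1 : ℝ) ≤ n := by exact_mod_cast hn
  have := mul_nonneg hp0.le (sub_nonneg.2 this)
  linarith

theorem threshold_le_gain (hp0 : 0 < p) (hp1 : p < 1) (hn : 1 ≤ n) (h1 : n ≠ 1)
    (hC : index p (n - 1) < C) : (n : ℝ) ≤ gain p C n := by
  have h0 := min_eq_zero_of_threshold hp0 (Or.inr hC) h1
  have hn' : (1 : ℝ) ≤ n := by exact_mod_cast hn
  have hg := gain_mul (C := C) hp0 hn
  rw [h0] at hg
  have h2 := mul_lt_mul_of_pos_left hC hp0
  have h3 : p * index p (n - 1) = p * (n - 1) * (n - 2) / 2 + (n - 1) := by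
    unfold index
    push_cast [hn]
    field_simp
    ring
  have h4 : 0 ≤ (1 - p) * (1 / p) := mul_nonneg (by linarith) (by positivity)
  have h5 : 0 ≤ (1 - p) * ((n : ℝ) - 1) := mul_nonneg (by linarith) (by linarith)
  refine le_of_mul_le_mul_right ?_ (factor_pos hp0 hn)
  rw [hg]
  linarith

/-- Below the threshold, updating is strictly worse than idling. -/
theorem idle_lt_update (hp0 : 0 < p) (hp1 : p < 1) (hC : n = 1 ∨ index p (n - 1) < C) {x : ℕ}
    (hx1 : 1 ≤ x) (hx : x < n) : x + meanValue p C n (x + 1) < C := by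
  have h1 : n ≠ 1 := by omega
  have hn : 1 ≤ n := by omega
  have hC' := hC.resolve_left h1
  have hD := factor_pos (p := p) hp0 hn
  have hpred := pred_threshold_identity hp0 hn (min_eq_zero_of_threshold hp0 hC h1)
  have h2 : 0 < C - ((n - 1) + meanValue p C n n) :=
    pos_of_mul_pos_right (by rw [hpred]; linarith) hD.le
  have hg := threshold_le_gain hp0 hp1 hn h1 hC'
  have hx' : (x : ℝ) + 1 ≤ n := by exact_mod_cast hx
  rw [meanValue_of_le le_rfl] at h2
  rw [meanValue_of_le hx]
  have h3 : 0 ≤ ((n : ℝ) - 1 - x) * (gain p C n - (n + x) / 2) :=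
    mul_nonneg (by linarith) (by linarith)
  push_cast
  linarith

theorem meanValue_succ_of_ge (hp0 : 0 < p) {x : ℕ} (hx : n ≤ x) :
    x + meanValue p C n (x + 1) = n + meanValue p C n (n + 1) + (x - n) / p := by
  rw [meanValue_of_ge (by omega), meanValue_of_ge (by omega)]
  push_cast
  field_simp
  ring

/-- From the threshold on, idling is no better than updating. -/
theorem update_le_idle (hp0 : 0 < p) (hn : 1 ≤ n) (hC : n = 1 ∨ index p (n - 1) < C)
    (hCn : C ≤ index p n) {x : ℕ} (hx : n ≤ x) : C ≤ x + meanValue p C n (x + 1) := by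
  have h1 := sub_threshold hp0 hn hC
  have h2 : C - (n + meanValue p C n (n + 1)) ≤ 0 :=
    nonpos_of_mul_nonpos_right (by rw [h1]; linarith) (factor_pos hp0 hn)
  have hx' : (n : ℝ) ≤ x := by exact_mod_cast hx
  have h3 : 0 ≤ ((x : ℝ) - n) / p := div_nonneg (by linarith) hp0.le
  rw [meanValue_succ_of_ge hp0 hx]
  linarith

/-- Updating and idling tie at age `x` exactly when `C` is the claimed index. -/
theorem eq_idle_iff (hp0 : 0 < p) (hp1 : p < 1) (hn : 1 ≤ n) (hC : n = 1 ∨ index p (n - 1) < C)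
    (hCn : C ≤ index p n) {x : ℕ} (hx1 : 1 ≤ x) :
    C = x + meanValue p C n (x + 1) ↔ C = index p x := by
  rcases lt_trichotomy x n with hx | rfl | hx
  · have h1 := idle_lt_update hp0 hp1 hC hx1 hx
    have h2 := (index_strictMono hp0).monotone (show x ≤ n - 1 by omega)
    have h3 := hC.resolve_left (by omega)
    exact iff_of_false (by linarith) (by linarith)
  · have h1 := sub_threshold hp0 hn hC
    rw [← sub_eq_zero, ← sub_eq_zero (b := index p x), ← h1]
    simp [(factor_pos (p := p) hp0 hn).ne']
  · have h1 := update_le_idle hp0 hn hC hCn le_rfl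
    have h2 := index_strictMono hp0 hx
    have hx' : (n : ℝ) < x := by exact_mod_cast hx
    have h3 : 0 < ((x : ℝ) - n) / p := div_pos (by linarith) hp0
    have h4 := meanValue_succ_of_ge (C := C) hp0 hx.le
    exact iff_of_false (by linarith) (by linarith)

theorem meanValue_eq (hp0 : 0 < p) (hp1 : p < 1) (hn : 1 ≤ n)
    (hC : n = 1 ∨ index p (n - 1) < C) (hCn : C ≤ index p n) (x : ℕ+) :
    meanValue p C n x = p * relValue p C n (x, true) + (1 - p) * relValue p C n (x, false) := by
  simp only [relValue, if_true, Bool.false_eq_true, if_false]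
  rcases lt_or_ge (x : ℕ) n with hx | hx
  · rw [min_eq_left (idle_lt_update hp0 hp1 hC x.pos hx).le,
      min_eq_zero_of_threshold hp0 hC (by have := x.pos; omega), meanValue_of_le hx.le,
      meanValue_of_le hx]
    push_cast
    ring
  · rw [min_eq_right (update_le_idle hp0 hn hC hCn hx), meanValue_of_ge hx,
      meanValue_of_ge (by omega)]
    have hg := gain_mul (C := C) hp0 hn
    push_cast
    field_simp
    field_simp at hg
    linear_combination hg

theorem abs_meanValue_le_of_le {x : ℕ} (hx1 : 1 ≤ x) (hx : x ≤ n) :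
    |meanValue p C n x| ≤ n * (|gain p C n| + 1 + n) := by
  have h1 : (1 : ℝ) ≤ x := by exact_mod_cast hx1
  have h2 : (x : ℝ) ≤ n := by exact_mod_cast hx
  rw [meanValue_of_le hx, abs_mul, abs_of_nonneg (by linarith)]
  refine mul_le_mul (by linarith) ?_ (abs_nonneg _) (by linarith)
  rw [abs_le]
  constructor <;> linarith [neg_abs_le (gain p C n), le_abs_self (gain p C n)]

theorem meanValue_bounds (hp0 : 0 < p) (hp1 : p < 1) (hn : 1 ≤ n) {x : ℕ} (hx1 : 1 ≤ x) :
    -(n * (|gain p C n| + 1 + n)) ≤ meanValue p C n x ∧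
      meanValue p C n x ≤ n * (|gain p C n| + 1 + n) + 1 / p * x := by
  have hx0 : 0 ≤ 1 / p * (x : ℝ) := by positivity
  rcases le_total x n with hx | hx
  · have h := abs_le.1 (abs_meanValue_le_of_le (p := p) (C := C) hx1 hx)
    exact ⟨h.1, by linarith [h.2]⟩
  · have h := abs_le.1 (abs_meanValue_le_of_le (p := p) (C := C) hn le_rfl)
    rw [meanValue_of_le le_rfl] at h
    rw [meanValue_of_ge hx]
    have hx' : (n : ℝ) ≤ x := by exact_mod_cast hx
    have hq : 0 ≤ (1 - p) / p := div_nonneg (by linarith) hp0.le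
    have hq' : (1 - p) / p ≤ 1 / p := div_le_div_of_nonneg_right (by linarith) hp0.le
    have h1 : 0 ≤ ((x : ℝ) - n) * ((1 - p) / p) := mul_nonneg (by linarith) hq
    have hn0 : (0 : ℝ) ≤ n := Nat.cast_nonneg n
    have h2 : ((x : ℝ) - n) * ((1 - p) / p) ≤ x * (1 / p) :=
      mul_le_mul (by linarith) hq' hq (by linarith)
    constructor <;> linarith [h.1, h.2]

end Explicit

section Solution

variable {p : unitInterval} {C : ℝ} {n : ℕ}

theorem qValue_relValue (hp0 : 0 < (p : ℝ)) (hp1 : (p : ℝ) < 1) (hn : 1 ≤ n)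
    (hC : n = 1 ∨ index p (n - 1) < C) (hCn : C ≤ index p n) (s : State) (a : Action) :
    qValue p C (relValue p C n) s a = cost C s a + meanValue p C n (nextAge s a) := by
  rw [qValue, meanValue_eq hp0 hp1 hn hC hCn]

theorem qValue_noArrival (hp0 : 0 < (p : ℝ)) (hp1 : (p : ℝ) < 1) (hn : 1 ≤ n)
    (hC : n = 1 ∨ index p (n - 1) < C) (hCn : C ≤ index p n) (x : ℕ+) (a : Action) :
    qValue p C (relValue p C n) (x, false) a
      = (x : ℕ) + 1 + C * a.toNat + meanValue p C n (x + 1) := by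
  rw [qValue_relValue hp0 hp1 hn hC hCn]
  simp [cost, nextAge]

theorem qValue_arrival_idle (hp0 : 0 < (p : ℝ)) (hp1 : (p : ℝ) < 1) (hn : 1 ≤ n)
    (hC : n = 1 ∨ index p (n - 1) < C) (hCn : C ≤ index p n) (x : ℕ+) :
    qValue p C (relValue p C n) (x, true) false
      = (x : ℕ) + 1 + meanValue p C n (x + 1) := by
  rw [qValue_relValue hp0 hp1 hn hC hCn]
  simp [cost, nextAge]

theorem qValue_arrival_update (hp0 : 0 < (p : ℝ)) (hp1 : (p : ℝ) < 1) (hn : 1 ≤ n)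
    (hC : n = 1 ∨ index p (n - 1) < C) (hCn : C ≤ index p n) (x : ℕ+) :
    qValue p C (relValue p C n) (x, true) true = 1 + C := by
  rw [qValue_relValue hp0 hp1 hn hC hCn]
  simp [cost, nextAge, meanValue_of_le hn]

theorem isACOESolution_relValue (hp0 : 0 < (p : ℝ)) (hp1 : (p : ℝ) < 1) (hn : 1 ≤ n)
    (hC : n = 1 ∨ index p (n - 1) < C) (hCn : C ≤ index p n) :
    IsACOESolution p C (gain p C n) (relValue p C n) where
  le_qValue := by
    rintro ⟨x, l⟩ a
    cases l
    · rw [qValue_noArrival hp0 hp1 hn hC hCn]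
      have h1 := min_le_left C 0
      have h2 := min_le_right C 0
      cases a <;> simp [relValue] <;> linarith
    · have h1 := min_le_left ((x : ℕ) + meanValue p C n (x + 1)) C
      have h2 := min_le_right ((x : ℕ) + meanValue p C n (x + 1)) C
      cases a
      · rw [qValue_arrival_idle hp0 hp1 hn hC hCn]
        simp only [relValue, if_true]
        linarith
      · rw [qValue_arrival_update hp0 hp1 hn hC hCn]
        simp only [relValue, if_true]
        linarith
  attained := by
    rintro ⟨x, l⟩
    cases l
    · rcases le_total C 0 with h | h
      · refine ⟨true, ?_⟩
        rw [qValue_noArrival hp0 hp1 hn hC hCn]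
        simp only [relValue, Bool.false_eq_true, if_false, min_eq_left h, Bool.toNat_true,
          Nat.cast_one]
        ring
      · refine ⟨false, ?_⟩
        rw [qValue_noArrival hp0 hp1 hn hC hCn]
        simp only [relValue, Bool.false_eq_true, if_false, min_eq_right h, Bool.toNat_false,
          Nat.cast_zero]
        ring
    · rcases le_total ((x : ℕ) + meanValue p C n (x + 1)) C with h | h
      · refine ⟨false, ?_⟩
        rw [qValue_arrival_idle hp0 hp1 hn hC hCn]
        simp only [relValue, if_true, min_eq_left h]
        ring
      · refine ⟨true, ?_⟩
        rw [qValue_arrival_update hp0 hp1 hn hC hCn]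
        simp only [relValue, if_true, min_eq_right h]
        ring
  upper := by
    refine ⟨1 + 1 / p, by positivity,
      n * (|gain p C n| + 1 + n) + 1 / p + 1 - gain p C n, fun s => ?_⟩
    have h := (meanValue_bounds (C := C) hp0 hp1 hn (Nat.le_add_left 1 (s.1 : ℕ))).2
    push_cast at h
    unfold relValue
    split_ifs
    · have h1 := min_le_left ((s.1 : ℕ) + meanValue p C n (s.1 + 1)) C
      linarith
    · have h1 := min_le_right C 0
      linarith
  lower := by
    refine ⟨min (-(n * (|gain p C n| + 1 + n))) C + min C 0 + 1 - gain p C n, fun s => ?_⟩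
    have h := (meanValue_bounds (C := C) hp0 hp1 hn (Nat.le_add_left 1 (s.1 : ℕ))).1
    have hx : (0 : ℝ) ≤ (s.1 : ℕ) := Nat.cast_nonneg _
    unfold relValue
    split_ifs
    · have h1 := min_le_right C 0
      have h2 : min (-(n * (|gain p C n| + 1 + n))) C ≤
          min ((s.1 : ℕ) + meanValue p C n (s.1 + 1)) C := min_le_min_right C (by linarith)
      linarith
    · have h1 := min_le_left (-(n * (|gain p C n| + 1 + n))) C
      linarith

end Solution

end AoI

theorem theorem4 (p : unitInterval) (hp0 : 0 < (p : ℝ)) (hp1 : (p : ℝ) < 1)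
    (x : ℕ+) :
    AoI.IsWhittleIndex p (x, false) 0 ∧
    AoI.IsWhittleIndex p (x, true)
      (((x : ℕ) : ℝ) ^ 2 / 2 - ((x : ℕ) : ℝ) / 2 + ((x : ℕ) : ℝ) / (p : ℝ)) := by
  constructor
  · intro C
    obtain ⟨n, hn, hCn, hC⟩ := AoI.exists_threshold hp0 hp1 C
    rw [(AoI.isACOESolution_relValue hp0 hp1 hn hC hCn).equallyDesirable_iff hp0 hp1,
      AoI.qValue_noArrival hp0 hp1 hn hC hCn, AoI.qValue_noArrival hp0 hp1 hn hC hCn]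
    simp
  · intro C
    obtain ⟨n, hn, hCn, hC⟩ := AoI.exists_threshold hp0 hp1 C
    rw [(AoI.isACOESolution_relValue hp0 hp1 hn hC hCn).equallyDesirable_iff hp0 hp1,
      AoI.qValue_arrival_idle hp0 hp1 hn hC hCn, AoI.qValue_arrival_update hp0 hp1 hn hC hCn]
    refine Iff.trans ?_ (AoI.eq_idle_iff hp0 hp1 hn hC hCn x.pos)
    constructor <;> intro h <;> linarith
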